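/- Let $N, D \ge 0$ be integers. Let $A_N^D$ be the space of polynomial maps $P : \mathbb{R}^N \to \mathbb{R}^N$ of degree at most $D$, i.e. of maps $P(x) = \sum_{|\alpha| \le D} a_\alpha x^\alpha$ with coefficients $a_\alpha \in \mathbb{R}^N$, where $\alpha$ runs over the multi-indices in $\mathbb{Z}_{\ge 0}^N$ with $|\alpha| = \alpha_1 + \dots + \alpha_N \le D$ and $x^\alpha = x_1^{\alpha_1} \cdots x_N^{\alpha_N}$; identify $A_N^D$ with the finite-dimensional real vector space of the coefficient families $(a_\alpha)_{|\alpha| \le D}$ and equip it with Lebesgue measure. Fix $\lambda_0 \in \mathbb{C}$ with $|\lambda_0| = 1$. Then for Lebesgue-almost every $P \in A_N^D$ the map $P$ has no periodic orbit with eigenvalue $\lambda_0$; that is, there are no integer $k \ge 1$ and no point $x \in \mathbb{R}^N$ such that $P^{k}(x) = x$, where $P^k$ is the $k$-fold composition of $P$ with itself, and $\lambda_0$ is an eigenvalue of the (complexified) linearization $d_x(P^{k})$ of $P^k$ at $x$. -/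

import Mathlib

open MeasureTheory

/-- The multi-indices `α = (α₁, …, α_N)` of natural numbers with `|α| = ∑ᵢ αᵢ ≤ D`. -/
abbrev MultiIndex (N D : ℕ) : Type := {α : Fin N → ℕ // ∑ i, α i ≤ D}

instance MultiIndex.instFinite (N D : ℕ) : Finite (MultiIndex N D) := by
  refine Set.Finite.subset (Set.finite_Iic (fun _ : Fin N => D)) ?_
  intro α hα i
  exact (Finset.single_le_sum (f := α) (fun j _ => Nat.zero_le _) (Finset.mem_univ i)).trans hα

noncomputable instance MultiIndex.instFintype (N D : ℕ) : Fintype (MultiIndex N D) :=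
  Fintype.ofFinite _

/-- The space of polynomial maps `ℝ^N → ℝ^N` of degree at most `D`, identified with the
finite-dimensional real space of families `(a_α)_{|α| ≤ D}` of coefficients `a_α ∈ ℝ^N`.
Its `volume` is the Lebesgue (product) measure. -/
abbrev PolyMapSpace (N D : ℕ) : Type := MultiIndex N D → Fin N → ℝ

/-- The polynomial map `P(a, x) = ∑_{|α| ≤ D} x^α a_α`, where `x^α = x₁^{α₁} ⋯ x_N^{α_N}`. -/
noncomputable def polyMap {N D : ℕ} (a : PolyMapSpace N D) (x : Fin N → ℝ) : Fin N → ℝ :=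
  ∑ α : MultiIndex N D, (∏ i, x i ^ α.1 i) • a α

/-- The linearization (Jacobian) matrix of `f` at `x`, viewed as a complex matrix. -/
noncomputable def complexJacobian {N : ℕ} (f : (Fin N → ℝ) → Fin N → ℝ) (x : Fin N → ℝ) :
    Matrix (Fin N) (Fin N) ℂ :=
  (LinearMap.toMatrix' (fderiv ℝ f x : (Fin N → ℝ) →ₗ[ℝ] Fin N → ℝ)).map Complex.ofReal

/-- `f` has a periodic orbit with eigenvalue `z`: for some `k ≥ 1` there is a point `x` with
`f^k(x) = x` at which the linearization of the `k`-fold iterate `f^k` has `z` as an eigenvalue.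
The number `k` is any period of `x`, not only the least one. -/
def HasPeriodicOrbitWithEigenvalue {N : ℕ} (f : (Fin N → ℝ) → Fin N → ℝ) (z : ℂ) : Prop :=
  ∃ k : ℕ, 0 < k ∧ ∃ x : Fin N → ℝ, Function.IsPeriodicPt f k x ∧
    Module.End.HasEigenvalue (Matrix.toLin' (complexJacobian f^[k] x)) z

/-!
A constant map has only the eigenvalue `0`. For `D ≥ 1` consider a line
`P_t(x) = P(x) + t (x₁ ^ D - 1, …, x_N ^ D - 1)` in the space of maps. If for infinitely many
complex `t` the map `P_t` had a point of period `k` with eigenvalue `c`, elimination would give such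
a point `y` for a transcendental `t` in an extension field `L` of `ℂ`. Choose a valuation `v` on `L`
which is trivial on `ℂ` and has `v(t) > 1`. A point with some `v(y_i) > 1` escapes to infinity, so
the orbit of `y` is integral; then `v(y_i ^ D - 1) < 1`, hence `v(y_i) = 1`, along the whole orbit.
There `t D y_i ^ (D - 1)` dominates the derivative, which therefore strictly expands the sup norm
attached to `v`, contradicting `v(c) ≤ 1`. So the bad maps meet each such line in a countable set,
and being a measurable set they are null by Fubini.
-/

lemma hasEigenvalue_toLin'_iff_isRoot_charpoly {K ι : Type*} [Field K] [Fintype ι] [DecidableEq ι]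
    {M : Matrix ι ι K} {c : K} :
    Module.End.HasEigenvalue (Matrix.toLin' M) c ↔ M.charpoly.IsRoot c := by
  rw [Module.End.hasEigenvalue_iff_isRoot_charpoly, Matrix.charpoly_toLin']

section PolynomialMaps

open MvPolynomial

variable {σ R S : Type*} [CommRing R] [CommRing S]

/-- The self-map of affine space `σ → R` whose components are the polynomials `f i`. -/
noncomputable def evalTuple (f : σ → MvPolynomial σ R) (x : σ → R) : σ → R :=
  fun i => eval x (f i)

/-- The formal Jacobian matrix of `evalTuple f` at `x`. -/
noncomputable def jacobian (f : σ → MvPolynomial σ R) (x : σ → R) : Matrix σ σ R :=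
  Matrix.of fun i j => eval x (pderiv j (f i))

lemma comp_evalTuple (φ : R →+* S) (f : σ → MvPolynomial σ R) (x : σ → R) :
    φ ∘ evalTuple f x = evalTuple (fun i => map φ (f i)) (φ ∘ x) := by
  ext i
  simp only [Function.comp_apply, evalTuple, eval_map]
  exact eval₂_comp φ x (f i)

lemma comp_iterate_evalTuple (φ : R →+* S) (f : σ → MvPolynomial σ R) (n : ℕ) (x : σ → R) :
    φ ∘ (evalTuple f)^[n] x = (evalTuple fun i => map φ (f i))^[n] (φ ∘ x) :=
  Function.Semiconj.iterate_right (comp_evalTuple φ f) n x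

lemma map_jacobian (φ : R →+* S) (f : σ → MvPolynomial σ R) (x : σ → R) :
    (jacobian f x).map φ = jacobian (fun i => map φ (f i)) (φ ∘ x) := by
  ext i j
  simpa [jacobian, evalTuple, pderiv_map] using
    congrFun (comp_evalTuple φ (fun i => pderiv j (f i)) x) i

variable [Fintype σ] [DecidableEq σ]

/-- The formal Jacobian matrix of the `n`-th iterate of `evalTuple f` at `x`, as given by the chain
rule along the orbit of `x`. -/
noncomputable def iterJacobian (f : σ → MvPolynomial σ R) : ℕ → (σ → R) → Matrix σ σ R
  | 0, _ => 1
  | n + 1, x => jacobian f ((evalTuple f)^[n] x) * iterJacobian f n x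

lemma map_iterJacobian (φ : R →+* S) (f : σ → MvPolynomial σ R) (n : ℕ) (x : σ → R) :
    (iterJacobian f n x).map φ = iterJacobian (fun i => map φ (f i)) n (φ ∘ x) := by
  induction n with
  | zero => simp [iterJacobian, Matrix.map_one]
  | succ n ih =>
    rw [iterJacobian, Matrix.map_mul, ih, map_jacobian, comp_iterate_evalTuple, iterJacobian]

/-- `x` is a point of period `k` of `evalTuple f` at which the formal Jacobian matrix of the `k`-th
iterate has the eigenvalue `c`. Being a root of the characteristic polynomial makes this a system of
polynomial equations in `x`, meaningful over any commutative ring. -/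
def IsPeriodicPtWithEigenvalue (f : σ → MvPolynomial σ R) (k : ℕ) (c : R) (x : σ → R) : Prop :=
  Function.IsPeriodicPt (evalTuple f) k x ∧ (iterJacobian f k x).charpoly.IsRoot c

/-- The equations which vanish exactly when `IsPeriodicPtWithEigenvalue f k c x`. -/
def periodicEigenvalueSystem (f : σ → MvPolynomial σ R) (k : ℕ) (c : R) (x : σ → R) : Set R :=
  insert ((iterJacobian f k x).charpoly.eval c)
    (Set.range fun i => (evalTuple f)^[k] x i - x i)

lemma isPeriodicPtWithEigenvalue_comp_iff (φ : R →+* S) (f : σ → MvPolynomial σ R) (k : ℕ) (c : R)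
    (x : σ → R) :
    IsPeriodicPtWithEigenvalue (fun i => map φ (f i)) k (φ c) (φ ∘ x) ↔
      ∀ e ∈ periodicEigenvalueSystem f k c x, φ e = 0 := by
  rw [IsPeriodicPtWithEigenvalue, Function.IsPeriodicPt, Function.IsFixedPt,
    ← comp_iterate_evalTuple, ← map_iterJacobian, Matrix.charpoly_map,
    Polynomial.IsRoot, Polynomial.eval_map_apply]
  simp [periodicEigenvalueSystem, funext_iff, sub_eq_zero, and_comm]

end PolynomialMaps

section Elimination

open Polynomial

universe u v

lemma exists_ne_zero_algebraMap_mem_ideal {R B : Type*} [CommRing R] [IsDomain R] [CommRing B]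
    [Algebra R B] (I : Ideal B)
    (h : ∀ p : Ideal B, p.IsPrime → I ≤ p → ∃ r : R, r ≠ 0 ∧ algebraMap R B r ∈ p) :
    ∃ r : R, r ≠ 0 ∧ algebraMap R B r ∈ I := by
  by_contra! hI
  have hdisj : Disjoint (I : Set B) (Algebra.algebraMapSubmonoid B (nonZeroDivisors R)) := by
    rw [Set.disjoint_left]
    rintro _ hb ⟨r, hr, rfl⟩
    exact hI r (nonZeroDivisors.ne_zero hr) hb
  obtain ⟨p, hp, hIp, hpS⟩ := Ideal.exists_le_prime_disjoint I _ hdisj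
  obtain ⟨r, hr, hrp⟩ := h p hp hIp
  exact Set.disjoint_left.1 hpS hrp ⟨r, mem_nonZeroDivisors_of_ne_zero hr, rfl⟩

lemma finite_setOf_exists_specialization {K : Type u} {B : Type v} [Field K] [CommRing B]
    [Algebra K[X] B] (E : Set B)
    (h : ∀ (L : Type v) [Field L] (Φ : B →+* L), (∀ e ∈ E, Φ e = 0) →
      ¬ Function.Injective (Φ.comp (algebraMap K[X] B))) :
    {t : K | ∃ ψ : B →+* K, ψ.comp (algebraMap K[X] B) = evalRingHom t ∧
      ∀ e ∈ E, ψ e = 0}.Finite := by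
  obtain ⟨r, hr, hrE⟩ : ∃ r : K[X], r ≠ 0 ∧ algebraMap K[X] B r ∈ Ideal.span E := by
    refine exists_ne_zero_algebraMap_mem_ideal _ fun p _ hEp => ?_
    have hker := h (FractionRing (B ⧸ p)) (algebraMap B _) fun e he => by
      rw [IsScalarTower.algebraMap_apply B (B ⧸ p), Ideal.Quotient.algebraMap_eq,
        Ideal.Quotient.eq_zero_iff_mem.2 (hEp (Ideal.subset_span he)), map_zero]
    rw [injective_iff_map_eq_zero] at hker
    push Not at hker
    obtain ⟨r, hr0, hr⟩ := hker
    refine ⟨r, hr, Ideal.Quotient.eq_zero_iff_mem.1 ?_⟩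
    refine IsFractionRing.injective (B ⧸ p) (FractionRing (B ⧸ p)) ?_
    rw [map_zero, ← hr0, RingHom.comp_apply, IsScalarTower.algebraMap_apply B (B ⧸ p),
      Ideal.Quotient.algebraMap_eq]
  refine (finite_setOfPred_isRoot hr).subset ?_
  rintro t ⟨ψ, hψ, hψE⟩
  have hle : Ideal.span E ≤ RingHom.ker ψ := Ideal.span_le.2 hψE
  have heval : ψ (algebraMap K[X] B r) = r.eval t := RingHom.congr_fun hψ r
  exact heval.symm.trans (hle hrE)

lemma finite_setOf_exists_isPeriodicPtWithEigenvalue {K : Type u} {σ : Type v} [Field K] [Fintype σ]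
    [DecidableEq σ] (f : σ → MvPolynomial σ K[X]) (k : ℕ) (c : K[X])
    (h : ∀ (L : Type (max u v)) [Field L] (g : K[X] →+* L), Function.Injective g → ∀ y : σ → L,
      ¬ IsPeriodicPtWithEigenvalue (fun i => MvPolynomial.map g (f i)) k (g c) y) :
    {t : K | ∃ x : σ → K, IsPeriodicPtWithEigenvalue
      (fun i => MvPolynomial.map (evalRingHom t) (f i)) k (c.eval t) x}.Finite := by
  -- A specialization of `K[t][x]` in `K` is a value of `t` together with a point `x`.
  let F : σ → MvPolynomial σ (MvPolynomial σ K[X]) := fun i => MvPolynomial.map MvPolynomial.C (f i)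
  refine (finite_setOf_exists_specialization (periodicEigenvalueSystem F k (MvPolynomial.C c)
    MvPolynomial.X) fun L _ Φ hΦ hinj => h L _ hinj (Φ ∘ MvPolynomial.X) ?_).subset ?_
  · simpa [F, MvPolynomial.map_map, MvPolynomial.algebraMap_eq] using
      (isPeriodicPtWithEigenvalue_comp_iff Φ F k _ _).2 hΦ
  · rintro t ⟨x, hx⟩
    let ψ : MvPolynomial σ K[X] →+* K := MvPolynomial.eval₂Hom (evalRingHom t) x
    have hψC : ψ.comp MvPolynomial.C = evalRingHom t := MvPolynomial.eval₂Hom_comp_C ..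
    refine ⟨ψ, hψC, (isPeriodicPtWithEigenvalue_comp_iff ψ F k _ _).1 ?_⟩
    have hψX : ψ ∘ MvPolynomial.X = x := funext fun i => MvPolynomial.eval₂Hom_X' ..
    have hψc : ψ (MvPolynomial.C c) = c.eval t := RingHom.congr_fun hψC c
    simpa only [F, MvPolynomial.map_map, hψC, hψX, hψc] using hx

lemma exists_valuationSubring_notMem {K L : Type*} [Field K] [Field L] (g : K[X] →+* L)
    (hg : Function.Injective g) :
    ∃ V : ValuationSubring L, (∀ c, g (C c) ∈ V) ∧ g X ∉ V := by
  let : Algebra K L := (g.comp C).toAlgebra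
  have hX : Transcendental K (g X) := by
    rw [transcendental_iff_injective]
    have haeval : (aeval (R := K) (g X) : K[X] →+* L) = g :=
      ringHom_ext (by simp [RingHom.algebraMap_toAlgebra]) (by simp)
    rwa [← haeval] at hg
  obtain ⟨V, hKV, hXV⟩ := Subring.exists_le_valuationSubring_of_isIntegrallyClosedIn
    (R := (integralClosure K L).toSubring) (x := g X) fun h => hX (IsIntegral.isAlgebraic h)
  exact ⟨V, fun c => hKV (algebraMap_mem (integralClosure K L) c), hXV⟩

end Elimination

section Pencil

open MvPolynomial Matrix

variable {σ R S : Type*} [CommRing R] [CommRing S]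

/-- The polynomial map `a + t • (x₁ ^ D - 1, …, x_N ^ D - 1)`. For large `t` its bounded orbits stay
near the simple zeros of `x ^ D - 1`, where it is expanding. -/
noncomputable def pencil (D : ℕ) (t : R) (a : σ → MvPolynomial σ R) : σ → MvPolynomial σ R :=
  fun i => C t * (X i ^ D - 1) + a i

lemma map_pencil (φ : R →+* S) (D : ℕ) (t : R) (a : σ → MvPolynomial σ R) :
    (fun i => map φ (pencil D t a i)) = pencil D (φ t) fun i => map φ (a i) := by
  ext1 i
  simp [pencil]

lemma evalTuple_pencil (D : ℕ) (t : R) (a : σ → MvPolynomial σ R) (y : σ → R) (i : σ) :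
    evalTuple (pencil D t a) y i = t * (y i ^ D - 1) + eval y (a i) := by
  simp [evalTuple, pencil]

lemma jacobian_pencil_mulVec [Fintype σ] (D : ℕ) (t : R) (a : σ → MvPolynomial σ R) (y u : σ → R)
    (i : σ) :
    (jacobian (pencil D t a) y *ᵥ u) i =
      t * (D * y i ^ (D - 1)) * u i + (jacobian a y *ᵥ u) i := by
  classical
  have hsplit : jacobian (pencil D t a) y =
      diagonal (fun i => t * (D * y i ^ (D - 1))) + jacobian a y := by
    ext i j
    rcases eq_or_ne i j with rfl | h
    · simp [jacobian, pencil]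
    · simp [jacobian, pencil, h]
  rw [hsplit, add_mulVec, Pi.add_apply, mulVec_diagonal]

end Pencil

section Valued

open MvPolynomial Matrix

variable {σ O L Γ : Type*} [CommRing O] [Field L] [LinearOrderedCommGroupWithZero Γ]

section Integral

lemma valuation_map_eq_one {K : Type*} [Field K] {v : Valuation L Γ} {ι : K →+* L}
    (hι : ∀ c, v (ι c) ≤ 1) {c : K} (hc : c ≠ 0) : v (ι c) = 1 := by
  refine (hι c).antisymm ?_
  simpa [hc] using inv_anti₀ (by simpa [v.pos_iff] using hc) (hι c⁻¹)

variable {v : Valuation L Γ} {ι : O →+* L} (hι : ∀ c, v (ι c) ≤ 1)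
include hι

lemma valuation_eval_map_le (p : MvPolynomial σ O) {y : σ → L} {r : Γ} (hr : 1 ≤ r)
    (hy : ∀ i, v (y i) ≤ r) : v (eval y (map ι p)) ≤ r ^ p.totalDegree := by
  rw [eval_map, eval₂_eq]
  refine v.map_sum_le fun s hs => ?_
  calc v (ι (p.coeff s) * ∏ i ∈ s.support, y i ^ s i)
      ≤ v (∏ i ∈ s.support, y i ^ s i) := by rw [map_mul]; exact mul_le_of_le_one_left' (hι _)
    _ ≤ ∏ i ∈ s.support, r ^ s i := by
      simp only [map_prod, map_pow]
      exact Finset.prod_le_prod' fun i _ => pow_le_pow_left' (hy i) _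
    _ = r ^ s.sum fun _ e => e := Finset.prod_pow_eq_pow_sum ..
    _ ≤ r ^ p.totalDegree := pow_le_pow_right' hr (le_totalDegree hs)

lemma valuation_eval_map_le_one (p : MvPolynomial σ O) {y : σ → L} (hy : ∀ i, v (y i) ≤ 1) :
    v (eval y (map ι p)) ≤ 1 := by
  simpa using valuation_eval_map_le hι p le_rfl hy

lemma valuation_eq_one_of_evalTuple_pencil_le_one {a : σ → MvPolynomial σ O} {t : L}
    (ht : 1 < v t) {D : ℕ} (hD : D ≠ 0) {y : σ → L} (hy : ∀ i, v (y i) ≤ 1)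
    (hfy : ∀ i, v (evalTuple (pencil D t fun j => map ι (a j)) y i) ≤ 1) (i : σ) :
    v (y i) = 1 := by
  have hprod : v (t * (y i ^ D - 1)) ≤ 1 := by
    have hsplit := evalTuple_pencil D t (fun j => map ι (a j)) y i
    rw [← sub_eq_iff_eq_add] at hsplit
    rw [← hsplit]
    exact v.map_sub_le (hfy i) (valuation_eval_map_le_one hι (a i) hy)
  have hnear : v (y i ^ D - 1) < 1 := by
    by_contra! h
    rw [map_mul] at hprod
    exact (ht.trans_le (le_mul_of_one_le_right' h)).not_ge hprod
  have hpow : v (y i) ^ D = 1 := by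
    rw [← map_pow, v.map_eq_of_sub_lt (x := 1) (by rwa [map_one]), map_one]
  exact (pow_eq_one_iff_of_nonneg zero_le hD).1 hpow

end Integral

variable [Fintype σ] (v : Valuation L Γ)

/-- The sup norm on `σ → L` attached to a valuation on `L`. -/
def supVal (y : σ → L) : Γ := Finset.univ.sup fun i => v (y i)

lemma valuation_le_supVal (y : σ → L) (i : σ) : v (y i) ≤ supVal v y :=
  Finset.le_sup (f := fun i => v (y i)) (Finset.mem_univ i)

lemma exists_valuation_eq_supVal {y : σ → L} (hy : 0 < supVal v y) : ∃ i, v (y i) = supVal v y := by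
  obtain ⟨j, -, -⟩ := Finset.lt_sup_iff.1 hy
  obtain ⟨i, -, hi⟩ := Finset.exists_mem_eq_sup _ ⟨j, Finset.mem_univ j⟩ fun i => v (y i)
  exact ⟨i, hi.symm⟩

lemma supVal_pos {u : σ → L} (hu : u ≠ 0) : 0 < supVal v u := by
  obtain ⟨i, hi⟩ := Function.ne_iff.1 hu
  exact (v.pos_iff.2 hi).trans_le (valuation_le_supVal v u i)

lemma supVal_smul_le {c : L} (hc : v c ≤ 1) (u : σ → L) : supVal v (c • u) ≤ supVal v u := by
  refine Finset.sup_le fun i _ => ?_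
  rw [Pi.smul_apply, smul_eq_mul, map_mul]
  exact (mul_le_of_le_one_left' hc).trans (valuation_le_supVal v u i)

variable {v} {ι : O →+* L} (hι : ∀ c, v (ι c) ≤ 1)
include hι

lemma valuation_jacobian_map_mulVec_le (a : σ → MvPolynomial σ O) {y : σ → L}
    (hy : ∀ i, v (y i) ≤ 1) (u : σ → L) (i : σ) :
    v ((jacobian (fun j => map ι (a j)) y *ᵥ u) i) ≤ supVal v u := by
  refine v.map_sum_le fun j _ => ?_
  have hentry : v (jacobian (fun j => map ι (a j)) y i j) ≤ 1 := by
    simpa [jacobian, pderiv_map] using valuation_eval_map_le_one hι (pderiv j (a i)) hy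
  rw [map_mul]
  exact (mul_le_of_le_one_left' hentry).trans (valuation_le_supVal v u j)

variable {a : σ → MvPolynomial σ O} {t : L} (ht : 1 < v t) {D : ℕ}
  (ha : ∀ i, (a i).totalDegree ≤ D)
include ht

include ha in
lemma supVal_lt_supVal_evalTuple_pencil (hD : D ≠ 0) {y : σ → L} (hy : 1 < supVal v y) :
    supVal v y < supVal v (evalTuple (pencil D t fun j => map ι (a j)) y) := by
  set r := supVal v y
  obtain ⟨m, hm⟩ := exists_valuation_eq_supVal v (zero_lt_one.trans hy)
  have hrD : 1 < r ^ D := one_lt_pow' hy hD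
  have hlead : v (t * (y m ^ D - 1)) = v t * r ^ D := by
    rw [map_mul, v.map_sub_eq_of_lt_left (by rwa [map_one, map_pow, hm]), map_pow, hm]
  have hexpand : r ^ D < v t * r ^ D := lt_mul_of_one_lt_left (zero_lt_one.trans hrD) ht
  have hrest : v (eval y (map ι (a m))) < v (t * (y m ^ D - 1)) := calc
    v (eval y (map ι (a m))) ≤ r ^ (a m).totalDegree :=
      valuation_eval_map_le hι _ hy.le (valuation_le_supVal v y)
    _ ≤ r ^ D := pow_le_pow_right' hy.le (ha m)
    _ < v (t * (y m ^ D - 1)) := hexpand.trans_eq hlead.symm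
  calc r ≤ r ^ D := le_self_pow hy.le hD
    _ < v t * r ^ D := hexpand
    _ = v (evalTuple (pencil D t fun j => map ι (a j)) y m) := by
      rw [evalTuple_pencil, v.map_add_eq_of_lt_left hrest, hlead]
    _ ≤ _ := valuation_le_supVal v _ m

include ha in
lemma supVal_le_one_of_isPeriodicPt_pencil (hD : D ≠ 0) {y : σ → L} {k : ℕ} (hk : 0 < k)
    (hy : Function.IsPeriodicPt (evalTuple (pencil D t fun j => map ι (a j))) k y) :
    supVal v y ≤ 1 := by
  set f := evalTuple (pencil D t fun j => map ι (a j))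
  by_contra! h
  have hescape (n : ℕ) : supVal v y < supVal v (f^[n + 1] y) := by
    induction n with
    | zero => exact supVal_lt_supVal_evalTuple_pencil hι ht ha hD h
    | succ n ih =>
      rw [Function.iterate_succ_apply']
      exact ih.trans (supVal_lt_supVal_evalTuple_pencil hι ht ha hD (h.trans ih))
  have hlt := hescape (k - 1)
  rw [Nat.sub_add_cancel hk, hy.eq] at hlt
  exact lt_irrefl _ hlt

variable (hD : v (D : L) = 1)
include hD

lemma supVal_lt_supVal_jacobian_pencil_mulVec {y u : σ → L} (hy : ∀ i, v (y i) = 1) (hu : u ≠ 0) :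
    supVal v u < supVal v (jacobian (pencil D t fun j => map ι (a j)) y *ᵥ u) := by
  have hpos := supVal_pos v hu
  obtain ⟨m, hm⟩ := exists_valuation_eq_supVal v hpos
  have hlead : v (t * (D * y m ^ (D - 1)) * u m) = v t * supVal v u := by
    simp [hD, hy, hm]
  have hexpand : supVal v u < v (t * (D * y m ^ (D - 1)) * u m) :=
    (lt_mul_of_one_lt_left hpos ht).trans_eq hlead.symm
  have hrest := (valuation_jacobian_map_mulVec_le hι a (fun i => (hy i).le) u m).trans_lt hexpand
  calc supVal v u < v (t * (D * y m ^ (D - 1)) * u m) := hexpand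
    _ = v ((jacobian (pencil D t fun j => map ι (a j)) y *ᵥ u) m) := by
      rw [jacobian_pencil_mulVec, v.map_add_eq_of_lt_left hrest]
    _ ≤ _ := valuation_le_supVal v _ m

variable [DecidableEq σ]

lemma supVal_lt_supVal_iterJacobian_pencil_mulVec {y u : σ → L}
    (hy : ∀ n i, v ((evalTuple (pencil D t fun j => map ι (a j)))^[n] y i) = 1) (hu : u ≠ 0)
    {n : ℕ} (hn : 0 < n) :
    supVal v u < supVal v (iterJacobian (pencil D t fun j => map ι (a j)) n y *ᵥ u) := by
  induction n, hn using Nat.le_induction with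
  | base => simpa [iterJacobian] using
      supVal_lt_supVal_jacobian_pencil_mulVec hι ht hD (hy 0) hu
  | succ n _ ih =>
    rw [iterJacobian, ← mulVec_mulVec]
    refine ih.trans (supVal_lt_supVal_jacobian_pencil_mulVec hι ht hD (hy n) fun h => ?_)
    simp [h, supVal] at ih

include ha in
theorem not_isPeriodicPtWithEigenvalue_pencil {k : ℕ} (hk : 0 < k) {c : L} (hc : v c ≤ 1)
    (y : σ → L) :
    ¬ IsPeriodicPtWithEigenvalue (pencil D t fun j => map ι (a j)) k c y := by
  rintro ⟨hy, hroot⟩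
  have hD0 : D ≠ 0 := by
    rintro rfl
    simp at hD
  have hint (n : ℕ) (i : σ) := (valuation_le_supVal v _ i).trans <|
    supVal_le_one_of_isPeriodicPt_pencil hι ht ha hD0 hk (hy.apply_iterate n)
  have hunit (n : ℕ) := valuation_eq_one_of_evalTuple_pencil_le_one hι ht hD0 (hint n) <| by
    simpa only [Function.iterate_succ_apply'] using hint (n + 1)
  obtain ⟨u, hu⟩ := (hasEigenvalue_toLin'_iff_isRoot_charpoly.2 hroot).exists_hasEigenvector
  have hlt := supVal_lt_supVal_iterJacobian_pencil_mulVec hι ht hD hunit hu.2 hk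
  rw [← toLin'_apply, hu.apply_eq_smul] at hlt
  exact hlt.not_ge (supVal_smul_le v hc u)

end Valued

theorem finite_setOf_exists_isPeriodicPtWithEigenvalue_pencil {K σ : Type*} [Field K] [Fintype σ]
    [DecidableEq σ] {D k : ℕ} (hD : (D : K) ≠ 0) (hk : 0 < k) {a : σ → MvPolynomial σ K}
    (ha : ∀ i, (a i).totalDegree ≤ D) (c : K) :
    {t : K | ∃ x, IsPeriodicPtWithEigenvalue (pencil D t a) k c x}.Finite := by
  have h := finite_setOf_exists_isPeriodicPtWithEigenvalue
    (pencil D Polynomial.X fun i => MvPolynomial.map Polynomial.C (a i)) k (Polynomial.C c) ?_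
  · have hC (t : K) : (Polynomial.evalRingHom t).comp Polynomial.C = RingHom.id K :=
      RingHom.ext fun b => Polynomial.eval_C
    simpa [map_pencil, MvPolynomial.map_map, hC, MvPolynomial.map_id] using h
  intro L _ g hg y
  obtain ⟨V, hKV, hXV⟩ := exists_valuationSubring_notMem g hg
  have hι (b : K) : V.valuation (g.comp Polynomial.C b) ≤ 1 := (V.valuation_le_one_iff _).2 (hKV b)
  have ht : 1 < V.valuation (g Polynomial.X) := by rwa [← not_le, V.valuation_le_one_iff]
  have hDV : V.valuation (D : L) = 1 := by
    simpa using valuation_map_eq_one hι hD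
  simpa only [map_pencil, MvPolynomial.map_map, RingHom.comp_apply] using
    not_isPeriodicPtWithEigenvalue_pencil hι ht ha hDV hk (hι c) y

section RealPolynomialMaps

open MvPolynomial

lemma hasFDerivAt_eval {𝕜 σ : Type*} [NontriviallyNormedField 𝕜] [Fintype σ]
    (p : MvPolynomial σ 𝕜) (x : σ → 𝕜) :
    HasFDerivAt (fun y => eval y p)
      (∑ j, eval x (pderiv j p) • (ContinuousLinearMap.proj j : (σ → 𝕜) →L[𝕜] 𝕜)) x := by
  classical
  induction p using MvPolynomial.induction_on with
  | C c =>
    simp only [eval_C]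
    exact (hasFDerivAt_const c x).congr_fderiv (by ext u; simp)
  | add p q hp hq =>
    simp only [map_add]
    refine (hp.fun_add hq).congr_fderiv ?_
    ext u
    simp [add_mul, Finset.sum_add_distrib]
  | mul_X p i hp =>
    simp only [map_mul, eval_X]
    refine (hp.fun_mul (hasFDerivAt_apply i x)).congr_fderiv ?_
    ext u
    simp [Derivation.leibniz, pderiv_X, Pi.single_apply, apply_ite (eval x), add_mul, mul_assoc,
      Finset.sum_add_distrib, Finset.mul_sum]

section Jacobian

variable {𝕜 σ : Type*} [NontriviallyNormedField 𝕜] [CompleteSpace 𝕜] [Fintype σ] [DecidableEq σ]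
  (f : σ → MvPolynomial σ 𝕜)

lemma hasFDerivAt_evalTuple (x : σ → 𝕜) :
    HasFDerivAt (evalTuple f) (Matrix.toLin' (jacobian f x)).toContinuousLinearMap x := by
  refine hasFDerivAt_pi'.2 fun i => (hasFDerivAt_eval (f i) x).congr_fderiv ?_
  ext u
  simp [jacobian, Matrix.mulVec, dotProduct]

lemma hasFDerivAt_iterate_evalTuple (n : ℕ) (x : σ → 𝕜) :
    HasFDerivAt (evalTuple f)^[n] (Matrix.toLin' (iterJacobian f n x)).toContinuousLinearMap x := by
  induction n with
  | zero => exact (hasFDerivAt_id x).congr_fderiv (by ext1 u; simp [iterJacobian])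
  | succ n ih =>
    rw [Function.iterate_succ']
    exact ((hasFDerivAt_evalTuple f _).comp x ih).congr_fderiv (by ext1 u; simp [iterJacobian])

end Jacobian

variable {N D : ℕ}

lemma complexJacobian_iterate_evalTuple (f : Fin N → MvPolynomial (Fin N) ℝ) (n : ℕ)
    (x : Fin N → ℝ) :
    complexJacobian (evalTuple f)^[n] x =
      iterJacobian (fun i => map Complex.ofRealHom (f i)) n (Complex.ofRealHom ∘ x) := by
  rw [complexJacobian, (hasFDerivAt_iterate_evalTuple f n x).fderiv, ← map_iterJacobian,
    LinearMap.coe_toContinuousLinearMap, LinearMap.toMatrix'_toLin']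
  rfl

lemma hasPeriodicOrbitWithEigenvalue_evalTuple_iff {f : Fin N → MvPolynomial (Fin N) ℝ} {z : ℂ} :
    HasPeriodicOrbitWithEigenvalue (evalTuple f) z ↔ ∃ k, 0 < k ∧ ∃ x : Fin N → ℝ,
      IsPeriodicPtWithEigenvalue (fun i => map Complex.ofRealHom (f i)) k z
        (Complex.ofRealHom ∘ x) := by
  have hinj : Function.Injective (Complex.ofRealHom ∘ · : (Fin N → ℝ) → _) :=
    Complex.ofReal_injective.comp_left
  simp only [HasPeriodicOrbitWithEigenvalue, IsPeriodicPtWithEigenvalue, Function.IsPeriodicPt,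
    Function.IsFixedPt, ← comp_iterate_evalTuple, hinj.eq_iff, complexJacobian_iterate_evalTuple,
    hasEigenvalue_toLin'_iff_isRoot_charpoly]

lemma countable_setOf_hasPeriodicOrbitWithEigenvalue_pencil (hD : D ≠ 0)
    {a : Fin N → MvPolynomial (Fin N) ℝ} (ha : ∀ i, (a i).totalDegree ≤ D) (z : ℂ) :
    {t : ℝ | HasPeriodicOrbitWithEigenvalue (evalTuple (pencil D t a)) z}.Countable := by
  have hdeg (i : Fin N) : (map Complex.ofRealHom (a i)).totalDegree ≤ D :=
    (Finset.sup_mono (support_map_subset _ _)).trans (ha i)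
  have hfin (k : ℕ) (hk : 0 < k) := finite_setOf_exists_isPeriodicPtWithEigenvalue_pencil
    (Nat.cast_ne_zero.2 hD) hk hdeg z
  refine ((Set.to_countable {k : ℕ | 0 < k}).biUnion fun k hk =>
    ((hfin k hk).preimage Complex.ofReal_injective.injOn).countable).mono fun t ht => ?_
  obtain ⟨k, hk, x, hx⟩ := hasPeriodicOrbitWithEigenvalue_evalTuple_iff.1 ht
  rw [map_pencil] at hx
  exact Set.mem_biUnion hk ⟨_, hx⟩

lemma polyMap_add_smul (b w : PolyMapSpace N D) (t : ℝ) (x : Fin N → ℝ) :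
    polyMap (b + t • w) x = polyMap b x + t • polyMap w x := by
  simp [polyMap, Finset.sum_add_distrib, Finset.smul_sum, smul_comm t]

lemma exists_evalTuple_eq_polyMap (a : PolyMapSpace N D) :
    ∃ f : Fin N → MvPolynomial (Fin N) ℝ, (∀ i, (f i).totalDegree ≤ D) ∧
      evalTuple f = polyMap a := by
  refine ⟨fun i => ∑ α, monomial (Finsupp.equivFunOnFinite.symm α.1) (a α i), fun i => ?_, ?_⟩
  · refine totalDegree_finsetSum_le fun α _ => (totalDegree_monomial_le _ _).trans ?_
    simpa [Finsupp.sum_fintype] using α.2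
  · ext x i
    simp [evalTuple, polyMap, eval_monomial, Finsupp.prod_fintype, mul_comm]

lemma exists_polyMap_eq_evalTuple {f : Fin N → MvPolynomial (Fin N) ℝ}
    (hf : ∀ i, (f i).totalDegree ≤ D) : ∃ a : PolyMapSpace N D, polyMap a = evalTuple f := by
  refine ⟨fun α i => (f i).coeff (Finsupp.equivFunOnFinite.symm α.1), ?_⟩
  ext x i
  simp only [polyMap, evalTuple, eval_eq', Finset.sum_apply, Pi.smul_apply, smul_eq_mul]
  refine Finset.sum_bij_ne_zero (fun α _ _ => Finsupp.equivFunOnFinite.symm α.1) ?_ ?_ ?_ ?_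
  · intro α _ hα
    exact mem_support_iff.2 (right_ne_zero_of_mul hα)
  · intro α _ _ β _ _ h
    exact Subtype.ext (Finsupp.equivFunOnFinite.symm.injective h)
  · intro d hd hne
    have hdD : ∑ j, d j ≤ D := by
      simpa [Finsupp.sum_fintype] using (le_totalDegree hd).trans (hf i)
    exact ⟨⟨d, hdD⟩, Finset.mem_univ _, by simpa [mul_comm] using hne, by simp⟩
  · intro α _ _
    simp [mul_comm]

lemma exists_polyMap_add_smul_eq_pencil (N D : ℕ) : ∃ w : PolyMapSpace N D, ∀ b,
    ∃ f : Fin N → MvPolynomial (Fin N) ℝ, (∀ i, (f i).totalDegree ≤ D) ∧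
      ∀ t : ℝ, polyMap (b + t • w) = evalTuple (pencil D t f) := by
  have hdeg (i : Fin N) : (X i ^ D - 1 : MvPolynomial (Fin N) ℝ).totalDegree ≤ D :=
    (totalDegree_sub _ _).trans (by simp)
  obtain ⟨w, hw⟩ := exists_polyMap_eq_evalTuple hdeg
  refine ⟨w, fun b => ?_⟩
  obtain ⟨f, hf, hfb⟩ := exists_evalTuple_eq_polyMap b
  refine ⟨f, hf, fun t => ?_⟩
  ext x i
  rw [polyMap_add_smul, hw, ← hfb, evalTuple_pencil]
  simp [evalTuple, add_comm]

end RealPolynomialMaps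

section Measurability

lemma measurableSet_of_isSigmaCompact {X : Type*} [TopologicalSpace X] [T2Space X]
    [MeasurableSpace X] [OpensMeasurableSpace X] {s : Set X} (hs : IsSigmaCompact s) :
    MeasurableSet s := by
  obtain ⟨K, hK, rfl⟩ := hs
  exact .iUnion fun n => (hK n).measurableSet

lemma contDiff_uncurry_iterate {E G : Type*} [NormedAddCommGroup E] [NormedSpace ℝ E]
    [NormedAddCommGroup G] [NormedSpace ℝ G] {n : WithTop ℕ∞} {F : E → G → G}
    (hF : ContDiff ℝ n (Function.uncurry F)) (k : ℕ) :
    ContDiff ℝ n (Function.uncurry fun a => (F a)^[k]) := by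
  induction k with
  | zero => exact contDiff_snd
  | succ k ih =>
    simp only [Function.iterate_succ']
    exact hF.comp (contDiff_fst.prodMk ih)

variable {N : ℕ} {E : Type*} [NormedAddCommGroup E] [NormedSpace ℝ E]
  {F : E → (Fin N → ℝ) → Fin N → ℝ}

lemma continuous_complexJacobian_iterate (hF : ContDiff ℝ 1 (Function.uncurry F)) (k : ℕ) :
    Continuous fun p : E × (Fin N → ℝ) => complexJacobian (F p.1)^[k] p.2 := by
  have hfderiv : Continuous fun p : E × (Fin N → ℝ) => fderiv ℝ (F p.1)^[k] p.2 := by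
    have hiter : ContDiff ℝ 1 (Function.uncurry fun (p : E × (Fin N → ℝ)) => (F p.1)^[k]) :=
      (contDiff_uncurry_iterate hF k).comp
        ((contDiff_fst.comp contDiff_fst).prodMk contDiff_snd)
    exact (hiter.fderiv contDiff_snd (by norm_num : (0 : WithTop ℕ∞) + 1 ≤ 1)).continuous
  refine Continuous.matrix_map (continuous_matrix fun i j => ?_) Complex.continuous_ofReal
  simp only [LinearMap.toMatrix'_apply, ContinuousLinearMap.coe_coe]
  fun_prop

lemma isClosed_setOf_isPeriodicPt_and_hasEigenvalue (hF : ContDiff ℝ 1 (Function.uncurry F))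
    (k : ℕ) (z : ℂ) :
    IsClosed {p : E × (Fin N → ℝ) | Function.IsPeriodicPt (F p.1) k p.2 ∧
      Module.End.HasEigenvalue (Matrix.toLin' (complexJacobian (F p.1)^[k] p.2)) z} := by
  simp only [hasEigenvalue_toLin'_iff_isRoot_charpoly, Polynomial.IsRoot, Matrix.eval_charpoly]
  refine (isClosed_eq (contDiff_uncurry_iterate hF k).continuous continuous_snd).inter
    (isClosed_eq ?_ continuous_const)
  exact (continuous_const.sub (continuous_complexJacobian_iterate hF k)).matrix_det

lemma measurableSet_setOf_hasPeriodicOrbitWithEigenvalue [FiniteDimensional ℝ E]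
    [MeasurableSpace E] [BorelSpace E] (hF : ContDiff ℝ 1 (Function.uncurry F)) (z : ℂ) :
    MeasurableSet {a | HasPeriodicOrbitWithEigenvalue (F a) z} := by
  have : ProperSpace E := FiniteDimensional.proper ℝ E
  have hproj (k : ℕ) := measurableSet_of_isSigmaCompact <|
    (isSigmaCompact_univ.of_isClosed_subset
      (isClosed_setOf_isPeriodicPt_and_hasEigenvalue hF k z) (Set.subset_univ _)).image
      continuous_fst
  convert MeasurableSet.iUnion fun k => MeasurableSet.iUnion fun _ : 0 < k => hproj k
  ext a
  simp [HasPeriodicOrbitWithEigenvalue]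

end Measurability

lemma contDiff_uncurry_polyMap {N D : ℕ} {n : WithTop ℕ∞} :
    ContDiff ℝ n (Function.uncurry (polyMap (N := N) (D := D))) := by
  unfold polyMap Function.uncurry
  fun_prop

lemma not_hasPeriodicOrbitWithEigenvalue_const {N : ℕ} (c : Fin N → ℝ) {z : ℂ} (hz : z ≠ 0) :
    ¬ HasPeriodicOrbitWithEigenvalue (fun _ => c) z := by
  rintro ⟨k, hk, x, -, hev⟩
  obtain ⟨n, rfl⟩ := Nat.exists_eq_add_one_of_ne_zero hk.ne'
  have hiter : (fun _ => c)^[n + 1] = fun _ : Fin N → ℝ => c := by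
    rw [Function.iterate_succ']
    rfl
  have hjac : complexJacobian (fun _ => c)^[n + 1] x = 0 := by
    ext i j
    rw [hiter]
    simp [complexJacobian]
  obtain ⟨u, hu⟩ := hev.exists_hasEigenvector
  have hzero := hu.apply_eq_smul
  rw [hjac, map_zero, LinearMap.zero_apply, eq_comm, smul_eq_zero] at hzero
  exact hzero.elim hz hu.2

lemma polyMap_eq_const_of_degree_zero {N : ℕ} (a : PolyMapSpace N 0) :
    ∃ c, polyMap a = fun _ => c := by
  refine ⟨∑ α, a α, ?_⟩
  ext x i
  have hα (α : MultiIndex N 0) (j : Fin N) : α.1 j = 0 :=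
    Finset.sum_eq_zero_iff.1 (Nat.le_zero.1 α.2) j (Finset.mem_univ j)
  simp [polyMap, hα]

theorem lemma1_general (N D : ℕ) (lam₀ : ℂ) (h : D = 0 → lam₀ ≠ 0) :
    ∀ᵐ a : PolyMapSpace N D ∂volume, ¬ HasPeriodicOrbitWithEigenvalue (polyMap a) lam₀ := by
  rcases eq_or_ne D 0 with rfl | hD
  · refine .of_forall fun a => ?_
    obtain ⟨c, hc⟩ := polyMap_eq_const_of_degree_zero a
    exact hc ▸ not_hasPeriodicOrbitWithEigenvalue_const c (h rfl)
  have hmeas := measurableSet_setOf_hasPeriodicOrbitWithEigenvalue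
    (contDiff_uncurry_polyMap (N := N) (D := D)) lam₀
  obtain ⟨w, hw⟩ := exists_polyMap_add_smul_eq_pencil N D
  refine ae_mem_of_ae_add_linearMap_mem (LinearMap.toSpanSingleton ℝ _ w) volume volume
    hmeas.compl fun b => ?_
  obtain ⟨f, hf, hfw⟩ := hw b
  have hcount := countable_setOf_hasPeriodicOrbitWithEigenvalue_pencil hD hf lam₀
  filter_upwards [hcount.ae_notMem volume] with t ht
  change ¬ HasPeriodicOrbitWithEigenvalue (polyMap (b + t • w)) lam₀
  rwa [hfw]

theorem lemma1 (N D : ℕ) (lam₀ : ℂ) (hlam₀ : ‖lam₀‖ = 1) :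
    ∀ᵐ a : PolyMapSpace N D ∂volume, ¬ HasPeriodicOrbitWithEigenvalue (polyMap a) lam₀ :=
  lemma1_general N D lam₀ fun _ => norm_ne_zero_iff.1 (hlam₀ ▸ one_ne_zero)
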